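/- For a finite simple graph $H$, a finite simple graph $G$ is called rainbow $H$-saturated if (a) there is a proper edge coloring of $G$ (with any number of colors) containing no rainbow copy of $H$, that is, no subgraph isomorphic to $H$ (not necessarily induced) all of whose edges have different colors; and (b) for every pair $e$ of distinct non-adjacent vertices of $G$, every proper edge coloring of $G+e$ contains a rainbow copy of $H$. Let $\operatorname{sat}^\star(n,H)$ denote the smallest number of edges in a rainbow $H$-saturated graph on $n$ vertices (with $\operatorname{sat}^\star(n,H)=\infty$ if there is no such graph). Theorem. Let $H$ be a finite simple graph with at least one edge that contains no cycle of even length ($C_4, C_6, C_8, \dots$) as an induced subgraph. Then there is a constant $c$, depending only on $H$, such that $\operatorname{sat}^\star(n,H)\le cn$ for every $n\ge 0$; in particular, a rainbow $H$-saturated graph on $n$ vertices exists for every $n$. -/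

import Mathlib

namespace RainbowSat

/-- An edge coloring is proper if distinct edges sharing a vertex get different colors. -/
def IsProper {V : Type*} {G : SimpleGraph V} (φ : G.EdgeLabeling ℕ) : Prop :=
  ∀ e f : G.edgeSet, e ≠ f → (∃ v : V, v ∈ (e : Sym2 V) ∧ v ∈ (f : Sym2 V)) → φ e ≠ φ f

/-- The edge coloring `φ` of `G` contains a rainbow copy of `H`: there is a (not necessarily
induced) copy of `H` in `G` whose edges get pairwise different colors. -/
def HasRainbowCopy {U V : Type*} (H : SimpleGraph U) {G : SimpleGraph V}
    (φ : G.EdgeLabeling ℕ) : Prop :=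
  ∃ f : H.Copy G, Function.Injective fun e : H.edgeSet => φ (f.mapEdgeSet e)

/-- `G` is rainbow `H`-saturated: some proper edge coloring of `G` has no rainbow copy of `H`,
and for every non-edge `uv`, every proper edge coloring of `G + uv` has a rainbow copy of `H`.
Colors are natural numbers; as `G` is finite in all uses, a coloring uses finitely many colors,
and the number of colors is not restricted. -/
def IsRainbowSaturated {U V : Type*} (H : SimpleGraph U) (G : SimpleGraph V) : Prop :=
  (∃ φ : G.EdgeLabeling ℕ, IsProper φ ∧ ¬ HasRainbowCopy H φ) ∧
  ∀ u v : V, u ≠ v → ¬ G.Adj u v →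
    ∀ φ : (G ⊔ SimpleGraph.edge u v).EdgeLabeling ℕ, IsProper φ → HasRainbowCopy H φ

/-- The rainbow saturation number: the smallest number of edges of a rainbow `H`-saturated graph
on `n` vertices (and `⊤` if there is no such graph). -/
noncomputable def sat {U : Type*} (n : ℕ) (H : SimpleGraph U) : ℕ∞ :=
  ⨅ (G : SimpleGraph (Fin n)) (_ : IsRainbowSaturated H G), G.edgeSet.encard

/-- `H` has no induced cycle of even length (the even cycles are `C₄, C₆, C₈, …`). -/
def EvenCycleFree {U : Type*} (H : SimpleGraph U) : Prop :=
  ∀ k : ℕ, 2 ≤ k → ¬ (SimpleGraph.cycleGraph (2 * k)).IsIndContained H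

end RainbowSat

open SimpleGraph

/-! Let `s + 2` be the chromatic number of `H` and fix an optimal coloring. Its last two classes
induce a bipartite graph, which is a forest: a shortest cycle would be even and induced. Start from
the complete multipartite graph with `s` blocks of constant size and one block for the rest. It is
`(s + 1)`-colorable, hence `H`-free, and extends to a saturated graph `G`
(`exists_isRainbowSaturated_ge`). If `G` were not `d`-degenerate for a suitable constant `d`, the
large block would contain a set `W` inducing large minimum degree. The forest then has a rainbow
embedding into `W`, and the other color classes go into the small blocks, one vertex at a time; this
contradicts the choice of `G` (`hasRainbowCopy_of_lt_degree`). So `G` has at most `d * n` edges. -/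

/-! ### Shortest cycles, forests and degeneracy -/

/-- A shortest cycle of a graph is an induced subgraph. -/
theorem SimpleGraph.cycleGraph_girth_isIndContained {V : Type*} {G : SimpleGraph V}
    (hG : ¬ G.IsAcyclic) : (cycleGraph G.girth).IsIndContained G := by
  obtain ⟨a, w, hw, hlen⟩ := exists_girth_eq_length.mpr hG
  have h3 := hw.three_le_length
  rw [hlen]
  have key : ∀ i j : ℕ, i < j → j < w.length →
      (G.Adj (w.getVert i) (w.getVert j) ↔ j = i + 1 ∨ (i = 0 ∧ j + 1 = w.length)) := by
    intro i j hij hj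
    constructor
    · intro hadj
      by_contra! hne
      have hend : (w.take j).getVert i = w.getVert i := by
        rw [Walk.take_getVert, min_eq_right hij.le]
      -- A chord closes this segment to a cycle of length `j - i + 1`, which is below the girth
      -- unless `i = 0` and `j` is the last index.
      set p : G.Walk (w.getVert i) (w.getVert j) := ((w.take j).drop i).copy hend rfl with hp
      have hpath : p.IsPath := by
        rw [hp, Walk.isPath_copy]
        exact (hw.isPath_take hj).drop i
      have hpl : p.length = j - i := by
        simp [hp, Walk.drop_length, Walk.take_length, min_eq_left hj.le]
      have hnot : s(w.getVert j, w.getVert i) ∉ p.edges := by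
        intro hmem
        rw [Sym2.eq_swap] at hmem
        have := hpath.length_eq_one_of_mem_edges hmem
        lia
      have hc : (Walk.cons hadj.symm p).IsCycle := (Walk.cons_isCycle_iff _ _).2 ⟨hpath, hnot⟩
      have := girth_le_length hc
      rw [Walk.length_cons] at this
      have := hne.2
      lia
    · rintro (rfl | ⟨rfl, hjl⟩)
      · exact w.adj_getVert_succ (by lia)
      · have := w.adj_getVert_succ (i := j) (by lia)
        rw [hjl, Walk.getVert_length] at this
        rw [Walk.getVert_zero]
        exact this.symm
  have key' : ∀ x y : Fin w.length, x < y →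
      (G.Adj (w.getVert x) (w.getVert y) ↔ (cycleGraph w.length).Adj x y) := by
    intro x y hxy
    rw [key x y hxy y.2, cycleGraph_adj', Fin.coe_sub_iff_lt.2 hxy, Fin.sub_val_of_le hxy.le]
    have : x.val < y.val := hxy
    have := y.2
    lia
  refine ⟨⟨⟨fun x => w.getVert x, ?_⟩, ?_⟩⟩
  · intro x y hxy
    have hx := x.2
    have hy := y.2
    exact Fin.ext (hw.getVert_injOn' (by simp only [Set.mem_ofPred_eq]; lia)
      (by simp only [Set.mem_ofPred_eq]; lia) hxy)
  · intro x y
    change G.Adj (w.getVert x) (w.getVert y) ↔ _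
    rcases lt_trichotomy x y with h | rfl | h
    · exact key' x y h
    · simp
    · rw [SimpleGraph.adj_comm, key' y x h, SimpleGraph.adj_comm]

/-- A bipartite induced subgraph of a graph without induced even cycles is a forest. -/
theorem RainbowSat.EvenCycleFree.induce_isAcyclic {U : Type*} {H : SimpleGraph U}
    (hH : RainbowSat.EvenCycleFree H) (A : Set U) (hA : (H.induce A).Colorable 2) :
    (H.induce A).IsAcyclic := by
  by_contra hc
  obtain ⟨a, w, hw, hlen⟩ := exists_girth_eq_length.mpr hc
  obtain ⟨k, hk⟩ := two_colorable_iff_forall_loop_even.1 hA a w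
  have h3 := hw.three_le_length
  refine hH k (by lia) ?_
  have := cycleGraph_girth_isIndContained hc
  rw [show 2 * k = (H.induce A).girth by lia]
  exact this.trans ⟨Embedding.induce A⟩

/-- A finite nonempty forest has a vertex with at most one neighbor. -/
theorem SimpleGraph.IsAcyclic.exists_subsingleton_neighborSet {V : Type*} [Finite V] [Nonempty V]
    {G : SimpleGraph V} (hG : G.IsAcyclic) : ∃ v, (G.neighborSet v).Subsingleton := by
  have := Fintype.ofFinite V
  obtain ⟨u, v, p, hp, hmax⟩ := Walk.exists_isPath_forall_isPath_length_le_length G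
  refine ⟨u, fun x hx y hy => ?_⟩
  -- A longest path cannot be prolonged at `u`; in a forest, a neighbor of `u` on the path must be
  -- its second vertex.
  have hmem : ∀ z, G.Adj u z → z ∈ p.support := by
    intro z hz
    by_contra hn
    have := hmax _ _ (Walk.cons hz.symm p) ((Walk.cons_isPath_iff _ _).2 ⟨hp, hn⟩)
    rw [Walk.length_cons] at this
    lia
  rw [hG.eq_snd_of_adj_start hp hx (hmem x hx), hG.eq_snd_of_adj_start hp hy (hmem y hy)]

/-- A graph in which every nonempty vertex set `S` has a vertex with at most `d` neighbors in `S`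
has at most `d` times as many edges as vertices. -/
theorem SimpleGraph.encard_edgeSet_le_of_degenerate {V : Type*} [Fintype V] [DecidableEq V]
    (G : SimpleGraph V) [DecidableRel G.Adj] (d : ℕ)
    (hd : ∀ S : Finset V, S.Nonempty → ∃ v ∈ S, (S.filter (G.Adj v)).card ≤ d) :
    G.edgeSet.encard ≤ (d : ℕ∞) * (Fintype.card V : ℕ∞) := by
  have main : ∀ n : ℕ, ∀ S : Finset V, S.card = n →
      {e ∈ G.edgeSet | ∀ x ∈ e, x ∈ S}.encard ≤ (d : ℕ∞) * (n : ℕ∞) := by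
    intro n
    induction n with
    | zero =>
      intro S hS
      rw [Finset.card_eq_zero] at hS
      subst hS
      have : {e ∈ G.edgeSet | ∀ x ∈ e, x ∈ (∅ : Finset V)} = ∅ := by
        ext e
        induction e with
        | _ x y => simpa using fun _ => ⟨x, fun h => (h rfl).elim⟩
      rw [this]
      simp
    | succ n ih =>
      intro S hS
      obtain ⟨v, hv, hdeg⟩ := hd S (Finset.card_pos.1 (by lia))
      have hsub : {e ∈ G.edgeSet | ∀ x ∈ e, x ∈ S} ⊆
          {e ∈ G.edgeSet | ∀ x ∈ e, x ∈ S.erase v} ∪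
            ((S.filter (G.Adj v)).image fun x => s(v, x) : Finset (Sym2 V)) := by
        intro e
        induction e with
        | _ x y =>
          simp only [Set.mem_union, Finset.coe_image, Set.mem_image, Finset.mem_coe,
            Finset.mem_filter, Set.mem_ofPred_eq, mem_edgeSet, Sym2.mem_iff, forall_eq_or_imp,
            forall_eq, Finset.mem_erase]
          rintro ⟨hxy, hx, hy⟩
          by_cases h1 : x = v
          · subst h1
            exact Or.inr ⟨y, ⟨hy, hxy⟩, rfl⟩
          · by_cases h2 : y = v
            · subst h2
              exact Or.inr ⟨x, ⟨hx, hxy.symm⟩, Sym2.eq_swap⟩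
            · exact Or.inl ⟨hxy, ⟨h1, hx⟩, h2, hy⟩
      refine (Set.encard_le_encard hsub).trans ((Set.encard_union_le _ _).trans ?_)
      have h1 := ih (S.erase v) (by rw [Finset.card_erase_of_mem hv]; lia)
      rw [Set.encard_coe_eq_coe_finsetCard]
      have h2 : (((S.filter (G.Adj v)).image fun x => s(v, x)).card : ℕ∞) ≤ d := by
        exact_mod_cast Finset.card_image_le.trans hdeg
      refine (add_le_add h1 h2).trans ?_
      push_cast
      rw [mul_add, mul_one]
  have h := main _ Finset.univ rfl
  simpa using h

/-! ### Greedy rainbow embeddings -/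

namespace RainbowSat

/-- `f` embeds the subgraph of `H` induced by `A` into `G` such that its edges get pairwise
different colors under `ψ`. -/
structure IsRainbowEmbeddingOn {U V : Type*} (H : SimpleGraph U) (G : SimpleGraph V)
    (ψ : Sym2 V → ℕ) (A : Finset U) (f : U → V) : Prop where
  inj : ∀ a ∈ A, ∀ b ∈ A, f a = f b → a = b
  adj : ∀ a ∈ A, ∀ b ∈ A, H.Adj a b → G.Adj (f a) (f b)
  rainbow : ∀ a ∈ A, ∀ b ∈ A, ∀ c ∈ A, ∀ d ∈ A, H.Adj a b → H.Adj c d →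
    ψ s(f a, f b) = ψ s(f c, f d) → s(a, b) = s(c, d)

/-- A rainbow embedding extends to a further vertex if there are many candidates for its image. -/
theorem IsRainbowEmbeddingOn.exists_extend {U V : Type*} [DecidableEq U]
    {H : SimpleGraph U} {G : SimpleGraph V} {ψ : Sym2 V → ℕ}
    (hψ : ∀ x y z, G.Adj x y → G.Adj x z → ψ s(x, y) = ψ s(x, z) → y = z)
    {A : Finset U} {f : U → V} (hf : IsRainbowEmbeddingOn H G ψ A f) {u : U} (hu : u ∉ A)
    (X : Finset V) (hX : ∀ x ∈ X, ∀ a ∈ A, H.Adj u a → G.Adj x (f a))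
    (hcard : A.card + A.card ^ 3 < X.card) :
    ∃ x ∈ X, IsRainbowEmbeddingOn H G ψ (insert u A) (Function.update f u x) := by
  classical
  -- For `t = (a, b, c)`: the candidates whose edge to `f a` repeats the color of `f b`, `f c`.
  -- Properness at `f a` leaves at most one, whence the `A.card ^ 3`; the other `A.card` counts used
  -- vertices.
  let clash : U × U × U → Finset V := fun t =>
    X.filter fun x => G.Adj x (f t.1) ∧ ψ s(x, f t.1) = ψ s(f t.2.1, f t.2.2)
  have hclash : ∀ t ∈ A ×ˢ A ×ˢ A, (clash t).card ≤ 1 := by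
    intro t _
    refine Finset.card_le_one.2 fun x hx y hy => ?_
    simp only [clash, Finset.mem_filter] at hx hy
    refine hψ (f t.1) x y hx.2.1.symm hy.2.1.symm ?_
    rw [Sym2.eq_swap, hx.2.2, Sym2.eq_swap (a := f t.1), hy.2.2]
  have hbad : (A.image f ∪ (A ×ˢ A ×ˢ A).biUnion clash).card < X.card := by
    refine lt_of_le_of_lt ((Finset.card_union_le _ _).trans ?_) hcard
    refine add_le_add Finset.card_image_le ((Finset.card_biUnion_le_card_mul _ _ 1 hclash).trans ?_)
    rw [Finset.card_product, Finset.card_product]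
    exact le_of_eq (by ring)
  obtain ⟨x, hxX, hx⟩ := Finset.exists_mem_notMem_of_card_lt_card hbad
  rw [Finset.mem_union, not_or, Finset.mem_biUnion] at hx
  obtain ⟨hx1, hx2⟩ := hx
  have hnew : ∀ a ∈ A, f a ≠ x := fun a ha h => hx1 (Finset.mem_image.2 ⟨a, ha, h⟩)
  have hcol : ∀ a ∈ A, ∀ b ∈ A, ∀ c ∈ A, H.Adj u a → ψ s(x, f a) ≠ ψ s(f b, f c) := by
    intro a ha b hb c hc hua h
    refine hx2 ⟨(a, b, c), by simp [ha, hb, hc], ?_⟩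
    simp only [clash, Finset.mem_filter]
    exact ⟨hxX, hX x hxX a ha hua, h⟩
  have hold : ∀ a ∈ A, Function.update f u x a = f a := fun a ha =>
    Function.update_of_ne (ne_of_mem_of_not_mem ha hu) _ _
  have hself : Function.update f u x u = x := Function.update_self _ _ _
  -- Two new edges share `x`, so properness separates them; a new and an old edge are separated by
  -- the choice of `x`.
  have hstar : ∀ a ∈ A, ∀ c ∈ insert u A, ∀ d ∈ insert u A, H.Adj u a → H.Adj c d →
      ψ s(x, f a) = ψ s(Function.update f u x c, Function.update f u x d) →
      s(u, a) = s(c, d) := by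
    intro a ha c hc d hd hua hcd h
    rw [Finset.mem_insert] at hc hd
    rcases hc with rfl | hc
    · rcases hd with rfl | hd
      · exact (hcd.ne rfl).elim
      · rw [hself, hold d hd] at h
        rw [hf.inj a ha d hd (hψ x _ _ (hX x hxX a ha hua) (hX x hxX d hd hcd) h)]
    · rcases hd with rfl | hd
      · rw [hself, hold c hc, Sym2.eq_swap (a := f c)] at h
        rw [hf.inj a ha c hc (hψ x _ _ (hX x hxX a ha hua) (hX x hxX c hc hcd.symm) h),
          Sym2.eq_swap]
      · rw [hold c hc, hold d hd] at h
        exact (hcol a ha c hc d hd hua h).elim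
  refine ⟨x, hxX, ⟨?_, ?_, ?_⟩⟩
  · intro a ha b hb h
    rw [Finset.mem_insert] at ha hb
    rcases ha with rfl | ha <;> rcases hb with rfl | hb
    · rfl
    · rw [hself, hold b hb] at h
      exact (hnew b hb h.symm).elim
    · rw [hself, hold a ha] at h
      exact (hnew a ha h).elim
    · rw [hold a ha, hold b hb] at h
      exact hf.inj a ha b hb h
  · intro a ha b hb h
    rw [Finset.mem_insert] at ha hb
    rcases ha with rfl | ha <;> rcases hb with rfl | hb
    · exact (h.ne rfl).elim
    · rw [hself, hold b hb]
      exact hX x hxX b hb h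
    · rw [hself, hold a ha]
      exact (hX x hxX a ha h.symm).symm
    · rw [hold a ha, hold b hb]
      exact hf.adj a ha b hb h
  · intro a ha b hb c hc d hd hab hcd h
    have hc₀ := hc
    have hd₀ := hd
    rw [Finset.mem_insert] at ha hb hc hd
    rcases ha with rfl | ha
    · rcases hb with rfl | hb
      · exact (hab.ne rfl).elim
      · rw [hself, hold b hb] at h
        exact hstar b hb c hc₀ d hd₀ hab hcd h
    · rcases hb with rfl | hb
      · rw [hself, hold a ha, Sym2.eq_swap (a := f a)] at h
        rw [← hstar a ha c hc₀ d hd₀ hab.symm hcd h, Sym2.eq_swap]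
      · rcases hc with rfl | hc
        · rcases hd with rfl | hd
          · exact (hcd.ne rfl).elim
          · rw [hself, hold a ha, hold b hb, hold d hd] at h
            exact (hcol d hd a ha b hb hcd h.symm).elim
        · rcases hd with rfl | hd
          · rw [hself, hold a ha, hold b hb, hold c hc, Sym2.eq_swap (a := f c)] at h
            exact (hcol c hc a ha b hb hcd.symm h.symm).elim
          · rw [hold a ha, hold b hb, hold c hc, hold d hd] at h
            exact hf.rainbow a ha b hb c hc d hd hab hcd h

/-- Forests have rainbow embeddings into properly colored graphs of large minimum degree. -/
theorem exists_isRainbowEmbeddingOn_of_isAcyclic {U V : Type*} [Fintype U] [Nonempty V]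
    {H : SimpleGraph U} {G : SimpleGraph V} [DecidableRel G.Adj] {ψ : Sym2 V → ℕ}
    (hψ : ∀ x y z, G.Adj x y → G.Adj x z → ψ s(x, y) = ψ s(x, z) → y = z)
    (W : Finset V) (hW : Fintype.card U + Fintype.card U ^ 3 < W.card)
    (hdeg : ∀ v ∈ W, Fintype.card U + Fintype.card U ^ 3 < (W.filter (G.Adj v)).card)
    (A : Finset U) (hA : (H.induce (A : Set U)).IsAcyclic) :
    ∃ f : U → V, IsRainbowEmbeddingOn H G ψ A f ∧ ∀ a ∈ A, f a ∈ W := by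
  classical
  induction hn : A.card generalizing A with
  | zero =>
    rw [Finset.card_eq_zero] at hn
    subst hn
    exact ⟨fun _ => Classical.arbitrary V, ⟨by simp, by simp, by simp⟩, by simp⟩
  | succ n ih =>
    have : Nonempty (A : Set U) := (Finset.card_pos.1 (by lia : 0 < A.card)).to_subtype
    obtain ⟨⟨u, hu⟩, hsub⟩ := hA.exists_subsingleton_neighborSet
    have hu' : u ∈ A := hu
    obtain ⟨f, hf, hfW⟩ := ih (A.erase u)
      (hA.embedding (induceHomOfLE H (by simp)))
      (by rw [Finset.card_erase_of_mem hu']; lia)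
    have hcard : (A.erase u).card + (A.erase u).card ^ 3 ≤
        Fintype.card U + Fintype.card U ^ 3 := by
      have := Finset.card_le_univ (A.erase u)
      gcongr
    have hext : ∃ x ∈ W, IsRainbowEmbeddingOn H G ψ (insert u (A.erase u))
        (Function.update f u x) := by
      by_cases hex : ∃ a ∈ A.erase u, H.Adj u a
      · obtain ⟨a, ha, hua⟩ := hex
        obtain ⟨x, hx, hx'⟩ := hf.exists_extend hψ (Finset.notMem_erase u A)
          (W.filter (G.Adj (f a))) (fun x hx b hb hub => by
            have : (⟨b, Finset.mem_of_mem_erase hb⟩ : (A : Set U)) =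
                ⟨a, Finset.mem_of_mem_erase ha⟩ := hsub hub hua
            have hba : b = a := congrArg Subtype.val this
            rw [hba]
            exact (Finset.mem_filter.1 hx).2.symm)
          (hcard.trans_lt (hdeg _ (hfW a ha)))
        exact ⟨x, (Finset.mem_filter.1 hx).1, hx'⟩
      · exact hf.exists_extend hψ (Finset.notMem_erase u A) W
          (fun x _ a ha hua => (hex ⟨a, ha, hua⟩).elim) (hcard.trans_lt hW)
    obtain ⟨x, hx, hx'⟩ := hext
    rw [Finset.insert_erase hu'] at hx'
    refine ⟨_, hx', fun a ha => ?_⟩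
    by_cases hau : a = u
    · subst hau
      rwa [Function.update_self]
    · rw [Function.update_of_ne hau]
      exact hfW a (Finset.mem_erase.2 ⟨hau, ha⟩)

/-- A rainbow embedding of a part `F` of `H` extends to all of `H` if every remaining vertex has
many candidates, joined completely to the candidates of its neighbors. -/
theorem IsRainbowEmbeddingOn.exists_extend_univ {U V : Type*} [Fintype U]
    {H : SimpleGraph U} {G : SimpleGraph V} {ψ : Sym2 V → ℕ}
    (hψ : ∀ x y z, G.Adj x y → G.Adj x z → ψ s(x, y) = ψ s(x, z) → y = z)
    {F : Finset U} {f : U → V} (hf : IsRainbowEmbeddingOn H G ψ F f) (X : U → Finset V)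
    (hfX : ∀ a ∈ F, f a ∈ X a)
    (hX : ∀ u ∉ F, ∀ a, H.Adj u a → ∀ x ∈ X u, ∀ y ∈ X a, G.Adj x y)
    (hcard : ∀ u ∉ F, Fintype.card U + Fintype.card U ^ 3 < (X u).card) :
    ∃ g : U → V, IsRainbowEmbeddingOn H G ψ Finset.univ g := by
  classical
  have main : ∀ B : Finset U, ∃ g : U → V, IsRainbowEmbeddingOn H G ψ (F ∪ B) g ∧
      ∀ a ∈ F ∪ B, g a ∈ X a := by
    intro B
    induction B using Finset.induction_on with
    | empty => exact ⟨f, by simpa using hf, by simpa using hfX⟩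
    | insert u B _ ih =>
      obtain ⟨g, hg, hgX⟩ := ih
      rw [Finset.union_insert]
      by_cases hu : u ∈ F ∪ B
      · rw [Finset.insert_eq_self.2 hu]
        exact ⟨g, hg, hgX⟩
      · have huF : u ∉ F := fun h => hu (Finset.mem_union_left _ h)
        obtain ⟨x, hx, hx'⟩ := hg.exists_extend hψ hu (X u)
          (fun x hx a ha hua => hX u huF a hua x hx _ (hgX a ha))
          (lt_of_le_of_lt (by have := Finset.card_le_univ (F ∪ B); gcongr) (hcard u huF))
        refine ⟨_, hx', fun a ha => ?_⟩
        by_cases hau : a = u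
        · subst hau
          rwa [Function.update_self]
        · rw [Function.update_of_ne hau]
          exact hgX a ((Finset.mem_insert.1 ha).resolve_left hau)
  obtain ⟨g, hg, -⟩ := main Finset.univ
  rw [Finset.union_eq_right.2 (Finset.subset_univ F)] at hg
  exact ⟨g, hg⟩

/-! ### Edge colorings and saturated graphs -/

/-- The colors of an edge coloring as a function on all unordered pairs. -/
noncomputable def colorFun {V : Type*} {G : SimpleGraph V} (φ : G.EdgeLabeling ℕ)
    (e : Sym2 V) : ℕ :=
  open Classical in if h : e ∈ G.edgeSet then φ ⟨e, h⟩ else 0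

theorem IsProper.eq_of_colorFun_eq {V : Type*} {G : SimpleGraph V} {φ : G.EdgeLabeling ℕ}
    (hφ : IsProper φ) (x y z : V) (hy : G.Adj x y) (hz : G.Adj x z)
    (h : colorFun φ s(x, y) = colorFun φ s(x, z)) : y = z := by
  by_contra hne
  have hy' : s(x, y) ∈ G.edgeSet := hy
  have hz' : s(x, z) ∈ G.edgeSet := hz
  rw [colorFun, colorFun, dif_pos hy', dif_pos hz'] at h
  refine hφ ⟨_, hy'⟩ ⟨_, hz'⟩ (fun he => hne ?_) ⟨x, by simp, by simp⟩ h
  exact Sym2.congr_right.1 (congrArg Subtype.val he)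

theorem IsRainbowEmbeddingOn.hasRainbowCopy {U V : Type*} [Fintype U] {H : SimpleGraph U}
    {G : SimpleGraph V} {φ : G.EdgeLabeling ℕ} {f : U → V}
    (hf : IsRainbowEmbeddingOn H G (colorFun φ) Finset.univ f) : HasRainbowCopy H φ := by
  refine ⟨⟨⟨f, fun {a b} h => hf.adj a (by simp) b (by simp) h⟩,
    fun a b h => hf.inj a (by simp) b (by simp) h⟩, ?_⟩
  rintro ⟨e, he⟩ ⟨e', he'⟩ h
  induction e with
  | _ a b =>
    induction e' with
    | _ c d =>
      refine Subtype.ext (hf.rainbow a (by simp) b (by simp) c (by simp) d (by simp) he he' ?_)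
      have h1 : s(f a, f b) ∈ G.edgeSet := hf.adj a (by simp) b (by simp) he
      have h2 : s(f c, f d) ∈ G.edgeSet := hf.adj c (by simp) d (by simp) he'
      rw [colorFun, colorFun, dif_pos h1, dif_pos h2]
      exact h

/-- Every finite `H`-free graph is contained in a rainbow `H`-saturated graph on the same
vertices. -/
theorem exists_isRainbowSaturated_ge {U V : Type*} [Finite V] (H : SimpleGraph U)
    (G₀ : SimpleGraph V) (hG₀ : IsEmpty (H.Copy G₀)) :
    ∃ G, G₀ ≤ G ∧ IsRainbowSaturated H G := by
  let P : Set (SimpleGraph V) :=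
    {G | ∃ φ : G.EdgeLabeling ℕ, IsProper φ ∧ ¬ HasRainbowCopy H φ}
  have h₀ : G₀ ∈ P := by
    obtain ⟨φ, hφ⟩ := Countable.exists_injective_nat G₀.edgeSet
    exact ⟨φ, fun e f hef _ h => hef (hφ h), fun ⟨f, _⟩ => hG₀.false f⟩
  -- Maximality in `P` is exactly what the non-edge condition of saturation needs.
  obtain ⟨G, hle, hmax⟩ := (Set.toFinite P).exists_le_maximal h₀
  refine ⟨G, hle, hmax.prop, fun u v huv hnadj φ hφ => ?_⟩
  by_contra hno
  have := hmax.le_of_ge (y := G ⊔ edge u v) ⟨φ, hφ, hno⟩ le_sup_left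
  exact hnadj (this (Or.inr ((edge_adj ..).2 ⟨Or.inl ⟨rfl, rfl⟩, huv⟩)))

/-! ### Blocks and the linear bound -/

/-- The vertices of an initial segment of the naturals are split into `s` blocks of size `t` and
the block of all remaining vertices. -/
def block (s t : ℕ) {n : ℕ} (v : Fin n) : ℕ := min (v / t) s

theorem le_card_block_eq {s t n i : ℕ} (hi : i < s) (hn : s * t ≤ n) :
    t ≤ (Finset.univ.filter fun v : Fin n => block s t v = i).card := by
  have hlt : ∀ j : Fin t, i * t + j < n := fun j => by
    have : (i + 1) * t ≤ s * t := Nat.mul_le_mul_right t hi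
    have := j.2
    lia
  have := Finset.card_le_card_of_injOn (s := (Finset.univ : Finset (Fin t)))
    (t := Finset.univ.filter fun v : Fin n => block s t v = i)
    (fun j => ⟨i * t + j, hlt j⟩) (fun j _ => by
      have ht : 0 < t := j.pos
      have : (i * t + j) / t = i := by
        rw [mul_comm, Nat.mul_add_div ht, Nat.div_eq_of_lt j.2, add_zero]
      rw [Finset.mem_coe, Finset.mem_filter, block, this]
      exact ⟨Finset.mem_univ _, min_eq_left hi.le⟩)
    (fun j _ k _ h => by simpa [Fin.ext_iff] using h)
  simpa using this

theorem card_block_lt_le (s n : ℕ) {t : ℕ} (ht : 0 < t) :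
    (Finset.univ.filter fun v : Fin n => block s t v < s).card ≤ s * t := by
  have := Finset.card_le_card_of_injOn (s := Finset.univ.filter fun v : Fin n => block s t v < s)
    (t := Finset.range (s * t)) (fun v => (v : ℕ)) (fun v hv => by
      simp only [block, Finset.coe_filter, Finset.mem_univ, true_and, Set.mem_ofPred_eq,
        min_lt_iff, lt_irrefl, or_false] at hv
      simp only [Finset.coe_range, Set.mem_Iio]
      by_contra! hle
      exact absurd ((Nat.le_div_iff_mul_le ht).2 hle) (not_le.2 hv))
    (fun v _ w _ h => Fin.ext h)
  simpa using this

end RainbowSat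

namespace RainbowSat

/-- Let `G` contain the complete multipartite graph on the blocks. If `H` has a proper vertex
coloring with colors `0, …, s + 1` such that the last two color classes induce a forest, then a
properly colored graph `G` of large minimum degree on some vertex set `S` has a rainbow copy
of `H`. -/
theorem hasRainbowCopy_of_lt_degree {U : Type*} [Fintype U] {H : SimpleGraph U} {s t n d : ℕ}
    (C : H.Coloring ℕ) (hforest : (H.induce {a | s ≤ C a}).IsAcyclic)
    (ht : Fintype.card U + Fintype.card U ^ 3 < t)
    (hd : s * t + (Fintype.card U + Fintype.card U ^ 3) ≤ d)
    {G : SimpleGraph (Fin n)} [DecidableRel G.Adj]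
    (hG : (⊤ : SimpleGraph ℕ).comap (block s t) ≤ G) {φ : G.EdgeLabeling ℕ} (hφ : IsProper φ)
    {S : Finset (Fin n)} (hS : S.Nonempty) (hdeg : ∀ v ∈ S, d < (S.filter (G.Adj v)).card) :
    HasRainbowCopy H φ := by
  classical
  obtain ⟨v₀, hv₀⟩ := hS
  -- For smaller `n` the small blocks would be truncated; a degree above `d ≥ s * t` excludes this.
  have hn : s * t ≤ n := by
    have h1 := hdeg v₀ hv₀
    have h2 := Finset.card_le_univ (S.filter (G.Adj v₀))
    rw [Fintype.card_fin] at h2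
    lia
  have : Nonempty (Fin n) := ⟨v₀⟩
  have ht₀ : 0 < t := by lia
  -- Restricting to the last block costs each vertex at most `s * t` neighbors.
  set W := S.filter fun v => s ≤ block s t v with hW
  have hWdeg : ∀ v ∈ W, Fintype.card U + Fintype.card U ^ 3 < (W.filter (G.Adj v)).card := by
    intro v hv
    have h1 := hdeg v (Finset.mem_filter.1 hv).1
    have h2 : S.filter (G.Adj v) ⊆
        W.filter (G.Adj v) ∪ Finset.univ.filter fun v : Fin n => block s t v < s := by
      intro x hx
      simp only [hW, Finset.mem_union, Finset.mem_filter, Finset.mem_univ, true_and] at hx ⊢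
      by_cases hxs : s ≤ block s t x
      · exact Or.inl ⟨⟨hx.1, hxs⟩, hx.2⟩
      · exact Or.inr (by lia)
    have h3 := (Finset.card_le_card h2).trans (Finset.card_union_le _ _)
    have h4 := card_block_lt_le s n ht₀
    lia
  have hWne : W.Nonempty := by
    by_contra hne
    rw [Finset.not_nonempty_iff_eq_empty, hW, Finset.filter_eq_empty_iff] at hne
    have h1 := hdeg v₀ hv₀
    have h2 : S.filter (G.Adj v₀) ⊆ Finset.univ.filter fun v : Fin n => block s t v < s := by
      intro x hx
      exact Finset.mem_filter.2 ⟨Finset.mem_univ _, not_le.1 (hne (Finset.mem_filter.1 hx).1)⟩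
    have h3 := Finset.card_le_card h2
    have h4 := card_block_lt_le s n ht₀
    lia
  obtain ⟨w, hw⟩ := hWne
  have hψ := hφ.eq_of_colorFun_eq
  let F : Finset U := Finset.univ.filter fun a => s ≤ C a
  have hFC : (F : Set U) = {a | s ≤ C a} := by
    ext
    simp [F]
  obtain ⟨f, hf, hfW⟩ := exists_isRainbowEmbeddingOn_of_isAcyclic (H := H) hψ W
    ((hWdeg w hw).trans_le (Finset.card_filter_le _ _)) hWdeg F (hFC ▸ hforest)
  -- Adjacent vertices, not both in the forest, get candidates in different blocks, which are
  -- completely joined.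
  let X : U → Finset (Fin n) := fun a =>
    if C a < s then Finset.univ.filter fun v => block s t v = C a else W
  have hF : ∀ a, a ∉ F ↔ C a < s := fun a => by simp [F]
  have hfX : ∀ a ∈ F, f a ∈ X a := by
    intro a ha
    have : ¬ C a < s := fun h => (hF a).2 h ha
    simpa only [X, if_neg this] using hfW a ha
  have hjoin : ∀ u ∉ F, ∀ a, H.Adj u a → ∀ x ∈ X u, ∀ y ∈ X a, G.Adj x y := by
    intro u hu a hua x hx y hy
    rw [hF] at hu
    have hne := C.valid hua
    simp only [X, if_pos hu, Finset.mem_filter, Finset.mem_univ, true_and] at hx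
    refine hG ?_
    rw [SimpleGraph.comap_adj, SimpleGraph.top_adj, hx]
    by_cases ha : C a < s
    · simp only [X, if_pos ha, Finset.mem_filter, Finset.mem_univ, true_and] at hy
      rwa [hy]
    · simp only [X, if_neg ha, hW, Finset.mem_filter] at hy
      lia
  have hcard : ∀ u ∉ F, Fintype.card U + Fintype.card U ^ 3 < (X u).card := by
    intro u hu
    rw [hF] at hu
    simp only [X, if_pos hu]
    exact ht.trans_le (le_card_block_eq hu hn)
  obtain ⟨g, hg⟩ := hf.exists_extend_univ hψ X hfX hjoin hcard
  exact hg.hasRainbowCopy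

/-- If `H` is `(s + 2)`-colorable but not `(s + 1)`-colorable and has a coloring where the last
two color classes induce a forest, then its rainbow saturation number is at most linear. -/
theorem sat_le_of_coloring {U : Type*} [Fintype U] {H : SimpleGraph U} {s : ℕ}
    (hs : ¬ H.Colorable (s + 1)) (C : H.Coloring ℕ)
    (hforest : (H.induce {a | s ≤ C a}).IsAcyclic) :
    ∃ c : ℕ, ∀ n : ℕ, sat n H ≤ (c : ℕ∞) * (n : ℕ∞) := by
  classical
  set K := Fintype.card U + Fintype.card U ^ 3 with hK
  refine ⟨s * (K + 1) + K, fun n => ?_⟩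
  -- A copy would pull the block index back to an `(s + 1)`-coloring of `H`.
  have hfree : IsEmpty (H.Copy ((⊤ : SimpleGraph ℕ).comap (block s (K + 1) (n := n)))) := by
    refine ⟨fun f => hs ⟨Coloring.mk
      (fun a => (⟨block s (K + 1) (f a), Nat.lt_succ_of_le (min_le_right _ _)⟩ : Fin (s + 1)))
      fun {a b} hab h => ?_⟩⟩
    exact f.toHom.map_adj hab (congrArg Fin.val h)
  obtain ⟨G, hG, hsat⟩ := exists_isRainbowSaturated_ge H _ hfree
  refine (iInf₂_le G hsat).trans ?_
  obtain ⟨φ, hφ, hno⟩ := hsat.1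
  have := G.encard_edgeSet_le_of_degenerate (s * (K + 1) + K) fun S hS => by
    by_contra! hdeg
    exact hno (hasRainbowCopy_of_lt_degree C hforest (Nat.lt_succ_self K) le_rfl hG hφ hS hdeg)
  rwa [Fintype.card_fin] at this

end RainbowSat

theorem mainTheorem1 {U : Type*} [Fintype U] (H : SimpleGraph U) (hne : H ≠ ⊥)
    (hH : RainbowSat.EvenCycleFree H) :
    ∃ c : ℕ, ∀ n : ℕ, RainbowSat.sat n H ≤ (c : ℕ∞) * (n : ℕ∞) := by
  classical
  have hone : ¬ H.Colorable 1 := by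
    rintro ⟨C⟩
    refine hne (eq_bot_iff.2 fun a b hab => (C.valid hab (Subsingleton.elim _ _)).elim)
  have hex : ∃ r, H.Colorable r := ⟨_, H.colorable_of_fintype⟩
  have hr : 2 ≤ Nat.find hex := by
    by_contra! h
    exact hone ((Nat.find_spec hex).mono (by lia))
  obtain ⟨s, hs⟩ := Nat.exists_eq_add_of_le' hr
  have hcol := Nat.find_spec hex
  rw [hs] at hcol
  have hmin : ¬ H.Colorable (s + 1) := Nat.find_min hex (by lia)
  obtain ⟨C⟩ := hcol
  refine RainbowSat.sat_le_of_coloring hmin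
    (Coloring.mk (fun a => (C a : ℕ)) fun {a b} hab h => C.valid hab (Fin.ext h)) ?_
  -- Only the colors `s` and `s + 1` remain, so subtracting `s` gives a 2-coloring.
  refine hH.induce_isAcyclic _ ⟨Coloring.mk
    (fun a => (⟨C a - s, by have := (C a).2; lia⟩ : Fin 2)) fun {a b} hab h => ?_⟩
  have ha : s ≤ (C a : ℕ) := a.2
  have hb : s ≤ (C b : ℕ) := b.2
  have h' : (C a : ℕ) - s = C b - s := congrArg Fin.val h
  have hne' : C a.1 ≠ C b.1 := C.valid hab
  exact hne' (Fin.ext (by lia))
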